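/- Let $C = 1 + \frac{\pi^2-4}{\pi^2+4} = 1.4231\ldots$. Let $G$ be a finite simple graph with $m$ edges and clique number $\omega(G)$, and let $\lambda_1 \ge \lambda_2 \ge \dots \ge \lambda_n$ be the eigenvalues of its adjacency matrix, counted with multiplicity. If $G$ is not a complete graph (so that in particular $n \ge 2$), then $$\lambda_1^2 + \lambda_2^2 \le \left(1 - \frac{1}{C\,\omega(G)}\right) 2m.$$ -/

import Mathlib

namespace SimpleGraph

theorem isHermitian_adjMatrix_real {V : Type*} (G : SimpleGraph V) [DecidableRel G.Adj] :
    (G.adjMatrix ℝ).IsHermitian := by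
  rw [Matrix.IsHermitian, Matrix.conjTranspose_eq_transpose_of_trivial]
  exact G.isSymm_adjMatrix

/-- The adjacency eigenvalues of a finite graph on `n` vertices, counted with multiplicity and
listed from largest to smallest; the index starts at `0`, so that the eigenvalue usually written
`λ₁` is `G.adjEigenvalue 0 _`, and `λ₂` is `G.adjEigenvalue 1 _`. -/
noncomputable def adjEigenvalue {V : Type*} [Fintype V] [DecidableEq V] (G : SimpleGraph V)
    [DecidableRel G.Adj] (k : ℕ) (hk : k < Fintype.card V) : ℝ :=
  G.isHermitian_adjMatrix_real.eigenvalues₀ ⟨k, hk⟩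

/-- A graph that is not complete has at least two vertices. -/
theorem one_lt_card_of_ne_top {V : Type*} [Fintype V] {G : SimpleGraph V} (hG : G ≠ ⊤) :
    1 < Fintype.card V := by
  by_contra h
  have : Subsingleton V := Fintype.card_le_one_iff_subsingleton.mp (not_lt.mp h)
  exact hG (Subsingleton.elim _ _)

end SimpleGraph

/-!
For `w ≥ 0` and a `K_{r+1}`-free graph with adjacency matrix `A`, the Motzkin-Straus inequality
reads `∑ (1 - A i j) w i w j ≥ (∑ w i)² / r`. Applied to the positive and negative parts of a signed
vector `w` it gives `∑ (1 - A i j) (w i w j + |w i| |w j|) ≥ ((∑ w i)² + (∑ |w i|)²) / r`. Now let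
the `w i` be complex numbers, apply this to their projections onto every direction, and integrate
over all directions. Two uses of Cauchy-Schwarz and the mean value `2 / π` of `|cos|` yield the same
inequality for complex numbers, with `1 / r` weakened to `8 / (π² r)`.

If `w i = z i ^ 2`, then `⟪w i, w j⟫ + ‖w i‖ ‖w j‖ = 2 ⟪z i, z j⟫²`. Taking
`z i = √λ₁ x i + √λ₂ y i * I` for orthonormal eigenvectors `x`, `y` with nonnegative eigenvalues,
the Gram matrix is `λ₁ x xᵀ + λ₂ y yᵀ`, so that `∑ ⟪z i, z j⟫² = λ₁² + λ₂² = ∑ A i j ⟪z i, z j⟫`,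
and Cauchy-Schwarz over the `2m` ordered adjacent pairs concludes. When the graph is not complete,
`λ₂ ≥ 0` because the quadratic form of `A` vanishes on the plane spanned by two nonadjacent
vertices.
-/

open Real Finset intervalIntegral InnerProductSpace

theorem sq_intervalIntegral_mul_le {f g : ℝ → ℝ} {a b : ℝ} (hf : Continuous f)
    (hg : Continuous g) (hab : a ≤ b) :
    (∫ θ in a..b, f θ * g θ) ^ 2 ≤ (∫ θ in a..b, f θ ^ 2) * ∫ θ in a..b, g θ ^ 2 := by
  have hquad (t : ℝ) : 0 ≤ (∫ θ in a..b, g θ ^ 2) * (t * t) +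
      2 * (∫ θ in a..b, f θ * g θ) * t + ∫ θ in a..b, f θ ^ 2 :=
    calc 0 ≤ ∫ θ in a..b, (t * g θ + f θ) ^ 2 :=
          integral_nonneg hab fun θ _ => sq_nonneg _
      _ = ∫ θ in a..b, (t * t) * g θ ^ 2 + (2 * t) * (f θ * g θ) + f θ ^ 2 := by
          congr! 2; ring
      _ = _ := by
          rw [integral_add (Continuous.intervalIntegrable (by fun_prop) _ _)
              (Continuous.intervalIntegrable (by fun_prop) _ _),
            integral_add (Continuous.intervalIntegrable (by fun_prop) _ _)
              (Continuous.intervalIntegrable (by fun_prop) _ _), integral_const_mul,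
            integral_const_mul]
          ring
  have := discrim_le_zero hquad
  rw [discrim] at this
  linarith

/-- The signed length of the projection of `w` onto the direction `e ^ (i θ)`. It turns complex
vectors into families of real ones, to which real inequalities are applied for each `θ` before
integrating over `[0, π]`. -/
noncomputable def directionalPart (θ : ℝ) (w : ℂ) : ℝ := w.re * cos θ + w.im * sin θ

theorem directionalPart_sum {ι : Type*} (s : Finset ι) (θ : ℝ) (w : ι → ℂ) :
    directionalPart θ (∑ i ∈ s, w i) = ∑ i ∈ s, directionalPart θ (w i) := by
  simp only [directionalPart, Complex.re_sum, Complex.im_sum, Finset.sum_mul,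
    Finset.sum_add_distrib]

@[fun_prop]
theorem continuous_directionalPart (w : ℂ) : Continuous fun θ => directionalPart θ w := by
  unfold directionalPart
  fun_prop

theorem directionalPart_eq_norm_mul_cos (θ : ℝ) (w : ℂ) :
    directionalPart θ w = ‖w‖ * cos (θ - w.arg) := by
  rw [directionalPart, ← Complex.norm_mul_cos_arg, ← Complex.norm_mul_sin_arg, cos_sub]
  ring

theorem integral_abs_directionalPart (w : ℂ) :
    ∫ θ in 0..π, |directionalPart θ w| = 2 * ‖w‖ := by
  have hper : Function.Periodic (fun θ => |cos θ|) π := fun θ => by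
    simp only [cos_add_pi, abs_neg]
  calc ∫ θ in 0..π, |directionalPart θ w|
      = ‖w‖ * ∫ θ in -w.arg..-w.arg + π, |cos θ| := by
        simp only [directionalPart_eq_norm_mul_cos, abs_mul, abs_norm]
        rw [integral_const_mul, integral_comp_sub_right (fun θ => |cos θ|), zero_sub,
          sub_eq_neg_add]
    _ = ‖w‖ * ∫ θ in -(π / 2)..π / 2, |cos θ| := by
        rw [hper.intervalIntegral_add_eq _ (-(π / 2)), neg_add_eq_sub, sub_half]
    _ = ‖w‖ * ∫ θ in -(π / 2)..π / 2, cos θ := by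
        congr 1
        refine integral_congr fun θ hθ => abs_of_nonneg (cos_nonneg_of_mem_Icc ?_)
        rwa [Set.uIcc_of_le (by linarith [pi_pos])] at hθ
    _ = 2 * ‖w‖ := by
        rw [integral_cos, sin_neg, sin_pi_div_two]
        ring

theorem integral_directionalPart_mul (w z : ℂ) :
    ∫ θ in 0..π, directionalPart θ w * directionalPart θ z = π / 2 * ⟪w, z⟫_ℝ := by
  have hexpand (θ : ℝ) : directionalPart θ w * directionalPart θ z =
      w.re * z.re * cos θ ^ 2 + (w.re * z.im + w.im * z.re) * (sin θ * cos θ) +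
        w.im * z.im * sin θ ^ 2 := by
    simp only [directionalPart]
    ring
  simp only [hexpand]
  rw [integral_add (Continuous.intervalIntegrable (by fun_prop) _ _)
      (Continuous.intervalIntegrable (by fun_prop) _ _),
    integral_add (Continuous.intervalIntegrable (by fun_prop) _ _)
      (Continuous.intervalIntegrable (by fun_prop) _ _),
    integral_const_mul, integral_const_mul, integral_const_mul, integral_cos_sq, integral_sin_sq,
    integral_sin_mul_cos₁, Complex.inner,
    Complex.mul_re, Complex.conj_re, Complex.conj_im]
  simp only [sin_zero, sin_pi, cos_zero, cos_pi]
  ring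

theorem integral_directionalPart_sq (w : ℂ) :
    ∫ θ in 0..π, directionalPart θ w ^ 2 = π / 2 * ‖w‖ ^ 2 := by
  simp only [sq, integral_directionalPart_mul, real_inner_self_eq_norm_mul_norm]

theorem integral_abs_directionalPart_mul_abs_le (w z : ℂ) :
    ∫ θ in 0..π, |directionalPart θ w| * |directionalPart θ z| ≤ π / 2 * (‖w‖ * ‖z‖) := by
  refine le_of_sq_le_sq ?_ (by positivity)
  have h := sq_intervalIntegral_mul_le (f := fun θ => |directionalPart θ w|)
    (g := fun θ => |directionalPart θ z|) (by fun_prop) (by fun_prop) pi_nonneg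
  simp only [sq_abs, integral_directionalPart_sq] at h
  exact h.trans_eq (by ring)

theorem le_integral_sq_sum_abs_directionalPart {ι : Type*} (s : Finset ι) (w : ι → ℂ) :
    4 / π * (∑ i ∈ s, ‖w i‖) ^ 2 ≤ ∫ θ in 0..π, (∑ i ∈ s, |directionalPart θ (w i)|) ^ 2 := by
  have hmean : ∫ θ in 0..π, ∑ i ∈ s, |directionalPart θ (w i)| = 2 * ∑ i ∈ s, ‖w i‖ := by
    rw [integral_finsetSum fun i _ => Continuous.intervalIntegrable (by fun_prop) _ _,
      Finset.mul_sum]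
    simp only [integral_abs_directionalPart]
  have h := sq_intervalIntegral_mul_le (f := fun θ => ∑ i ∈ s, |directionalPart θ (w i)|)
    (g := fun _ => 1) (by fun_prop) (by fun_prop) pi_nonneg
  simp only [mul_one, one_pow, hmean, integral_const, smul_eq_mul, sub_zero] at h
  rw [div_mul_eq_mul_div, div_le_iff₀ pi_pos]
  linarith

theorem le_integral_sq_sum_add_sq_sum_abs_directionalPart {ι : Type*} (s : Finset ι) (w : ι → ℂ) :
    4 / π * ∑ i ∈ s, ∑ j ∈ s, (⟪w i, w j⟫_ℝ + ‖w i‖ * ‖w j‖) ≤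
      ∫ θ in 0..π, (∑ i ∈ s, directionalPart θ (w i)) ^ 2 +
        (∑ i ∈ s, |directionalPart θ (w i)|) ^ 2 := by
  have hsum : ∑ i ∈ s, ∑ j ∈ s, (⟪w i, w j⟫_ℝ + ‖w i‖ * ‖w j‖) =
      ‖∑ i ∈ s, w i‖ ^ 2 + (∑ i ∈ s, ‖w i‖) ^ 2 := by
    simp only [sum_add_distrib, ← inner_sum, ← sum_inner, real_inner_self_eq_norm_sq, ← sum_mul_sum,
      ← sq]
  have hcoef : 4 / π ≤ π / 2 := by
    rw [div_le_div_iff₀ pi_pos two_pos]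
    nlinarith [pi_gt_three]
  rw [hsum, mul_add, integral_add (Continuous.intervalIntegrable (by fun_prop) _ _)
    (Continuous.intervalIntegrable (by fun_prop) _ _)]
  simp only [← directionalPart_sum, integral_directionalPart_sq]
  gcongr
  exact le_integral_sq_sum_abs_directionalPart s w

theorem integral_directionalPart_mul_add_abs_mul_abs_le (w z : ℂ) :
    ∫ θ in 0..π, directionalPart θ w * directionalPart θ z +
      |directionalPart θ w| * |directionalPart θ z| ≤ π / 2 * (⟪w, z⟫_ℝ + ‖w‖ * ‖z‖) := by
  rw [integral_add (Continuous.intervalIntegrable (by fun_prop) _ _)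
    (Continuous.intervalIntegrable (by fun_prop) _ _), integral_directionalPart_mul, mul_add]
  gcongr
  exact integral_abs_directionalPart_mul_abs_le w z

theorem sum_sum_le_sum_filter_add_two_mul {ι : Type*} {f : ι → ι → ℝ} (hf : 0 ≤ f)
    (hsymm : ∀ i j, f i j = f j i) (s : Finset ι) (p : ι → Prop) [DecidablePred p] :
    ∑ i ∈ s, ∑ j ∈ s, f i j ≤
      ∑ i ∈ s with p i, ∑ j ∈ s with p j, f i j + 2 * ∑ i ∈ s with ¬p i, ∑ j ∈ s, f i j := by
  have hcross : ∑ i ∈ s with p i, ∑ j ∈ s with ¬p j, f i j ≤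
      ∑ i ∈ s with ¬p i, ∑ j ∈ s, f i j := by
    rw [sum_comm]
    simp only [hsymm]
    exact sum_le_sum fun j _ =>
      sum_le_sum_of_subset_of_nonneg (filter_subset p s) fun i _ _ => hf j i
  have hsplit (i : ι) : ∑ j ∈ s, f i j = ∑ j ∈ s with p j, f i j + ∑ j ∈ s with ¬p j, f i j :=
    (sum_filter_add_sum_filter_not s p _).symm
  rw [← sum_filter_add_sum_filter_not s p, sum_congr rfl fun i (_ : i ∈ s.filter p) => hsplit i,
    sum_add_distrib]
  linarith

section CliqueFree

variable {V : Type*} {G : SimpleGraph V} {r : ℕ}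

theorem cliqueFreeOn_one_iff {s : Set V} : G.CliqueFreeOn s 1 ↔ s = ∅ := by
  refine ⟨fun hs => Set.eq_empty_of_forall_notMem fun v hv => ?_, by rintro rfl; simp⟩
  simpa using hs.subset _ (Set.singleton_subset_iff.mpr hv)

theorem sum_sum_adjMatrix_mul_le_filter_adj [DecidableRel G.Adj] {w : V → ℝ} (hw : 0 ≤ w)
    {s : Finset V} {v : V}
    (hv : ∀ i ∈ s, ∑ j ∈ s, G.adjMatrix ℝ i j * w j ≤ ∑ j ∈ s, G.adjMatrix ℝ v j * w j) :
    ∑ i ∈ s, ∑ j ∈ s, G.adjMatrix ℝ i j * (w i * w j) ≤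
      ∑ i ∈ s with G.Adj v i, ∑ j ∈ s with G.Adj v j, G.adjMatrix ℝ i j * (w i * w j) +
        2 * ((∑ i ∈ s with ¬G.Adj v i, w i) * ∑ i ∈ s with G.Adj v i, w i) := by
  have hdeg : ∑ j ∈ s, G.adjMatrix ℝ v j * w j = ∑ j ∈ s with G.Adj v j, w j := by
    simp only [SimpleGraph.adjMatrix_apply, ite_mul, one_mul, zero_mul, sum_filter]
  refine (sum_sum_le_sum_filter_add_two_mul (fun i j => ?_) (fun i j => ?_) s (G.Adj v)).trans ?_
  · have : 0 ≤ G.adjMatrix ℝ i j := by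
      rw [SimpleGraph.adjMatrix_apply]
      positivity
    exact mul_nonneg this (mul_nonneg (hw i) (hw j))
  · rw [G.isSymm_adjMatrix.apply, mul_comm (w i)]
  · gcongr
    rw [sum_mul, ← hdeg]
    refine sum_le_sum fun i hi => ?_
    simp only [mul_left_comm _ (w i), ← mul_sum]
    exact mul_le_mul_of_nonneg_left (hv i (mem_filter.mp hi).1) (hw i)

theorem one_sub_one_div_mul_sq_add_two_mul_le {r : ℝ} (hr : 0 < r) (a d : ℝ) :
    (1 - 1 / r) * d ^ 2 + 2 * (a * d) ≤ (1 - 1 / (r + 1)) * (d + a) ^ 2 := by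
  have h : (1 - 1 / (r + 1)) * (d + a) ^ 2 - ((1 - 1 / r) * d ^ 2 + 2 * (a * d)) =
      (d - r * a) ^ 2 / (r * (r + 1)) := by
    field_simp
    ring
  have : 0 ≤ (d - r * a) ^ 2 / (r * (r + 1)) := by positivity
  linarith

-- The Motzkin-Straus inequality, by Turán's argument: the weight inside the neighbourhood of a
-- vertex of maximal weighted degree is bounded by induction, the rest by that maximal degree.
theorem sum_sum_adjMatrix_mul_le_of_cliqueFreeOn [DecidableRel G.Adj] {w : V → ℝ} (hw : 0 ≤ w)
    {s : Finset V} (hs : G.CliqueFreeOn s (r + 1)) :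
    ∑ i ∈ s, ∑ j ∈ s, G.adjMatrix ℝ i j * (w i * w j) ≤ (1 - 1 / r) * (∑ i ∈ s, w i) ^ 2 := by
  induction r generalizing s with
  | zero => simp [coe_eq_empty.mp (cliqueFreeOn_one_iff.mp hs)]
  | succ r ih =>
    rcases s.eq_empty_or_nonempty with rfl | hne
    · simp
    obtain ⟨v, hvs, hmax⟩ :=
      exists_max_image s (fun i => ∑ j ∈ s, G.adjMatrix ℝ i j * w j) hne
    have hnbr : G.CliqueFreeOn (s.filter (G.Adj v) : Finset V) (r + 1) := by
      simpa [Set.inter_def] using hs.of_succ _ hvs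
    refine (sum_sum_adjMatrix_mul_le_filter_adj hw hmax).trans ?_
    rw [← sum_filter_add_sum_filter_not s (G.Adj v) w, Nat.cast_succ]
    rcases r.eq_zero_or_pos with rfl | hr
    · simp [coe_eq_empty.mp (cliqueFreeOn_one_iff.mp hnbr)]
    · exact (add_le_add_left (ih hnbr) _).trans
        (one_sub_one_div_mul_sq_add_two_mul_le (Nat.cast_pos.mpr hr) _ _)

end CliqueFree

section MotzkinStraus

variable {V : Type*} [Fintype V] {G : SimpleGraph V} [DecidableRel G.Adj] {r : ℕ}

theorem sq_sum_le_sum_one_sub_adjMatrix_mul (hG : G.CliqueFree (r + 1)) {w : V → ℝ} (hw : 0 ≤ w) :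
    1 / r * (∑ i, w i) ^ 2 ≤ ∑ i, ∑ j, (1 - G.adjMatrix ℝ i j) * (w i * w j) := by
  have h := sum_sum_adjMatrix_mul_le_of_cliqueFreeOn (s := univ) hw hG.cliqueFreeOn
  simp only [one_sub_mul, sum_sub_distrib, ← sum_mul_sum, ← sq] at h ⊢
  linarith

theorem sq_sum_add_sq_sum_abs_le (hG : G.CliqueFree (r + 1)) (w : V → ℝ) :
    1 / r * ((∑ i, w i) ^ 2 + (∑ i, |w i|) ^ 2) ≤
      ∑ i, ∑ j, (1 - G.adjMatrix ℝ i j) * (w i * w j + |w i| * |w j|) := by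
  have hpos := sq_sum_le_sum_one_sub_adjMatrix_mul hG (w := |w| + w) fun i => by
    simpa using neg_le_iff_add_nonneg'.mp (neg_abs_le (w i))
  have hneg := sq_sum_le_sum_one_sub_adjMatrix_mul hG (w := |w| - w) fun i => by
    simpa using le_abs_self (w i)
  simp only [Pi.add_apply, Pi.sub_apply, Pi.abs_apply, sum_add_distrib, sum_sub_distrib]
    at hpos hneg
  have hterm : ∑ i, ∑ j, (1 - G.adjMatrix ℝ i j) * ((|w i| + w i) * (|w j| + w j)) +
      ∑ i, ∑ j, (1 - G.adjMatrix ℝ i j) * ((|w i| - w i) * (|w j| - w j)) =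
      2 * ∑ i, ∑ j, (1 - G.adjMatrix ℝ i j) * (w i * w j + |w i| * |w j|) := by
    simp only [mul_sum, ← sum_add_distrib]
    congr! 2
    ring
  linarith

theorem sum_sum_inner_add_norm_mul_norm_le (hG : G.CliqueFree (r + 1)) (w : V → ℂ) :
    8 / π ^ 2 / r * ∑ i, ∑ j, (⟪w i, w j⟫_ℝ + ‖w i‖ * ‖w j‖) ≤
      ∑ i, ∑ j, (1 - G.adjMatrix ℝ i j) * (⟪w i, w j⟫_ℝ + ‖w i‖ * ‖w j‖) := by
  have hnonneg (i j : V) : 0 ≤ 1 - G.adjMatrix ℝ i j := by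
    rw [SimpleGraph.adjMatrix_apply]
    split_ifs <;> norm_num
  refine le_of_mul_le_mul_left ?_ (half_pos pi_pos)
  calc π / 2 * (8 / π ^ 2 / r * ∑ i, ∑ j, (⟪w i, w j⟫_ℝ + ‖w i‖ * ‖w j‖))
      = 1 / r * (4 / π * ∑ i, ∑ j, (⟪w i, w j⟫_ℝ + ‖w i‖ * ‖w j‖)) := by
        field_simp
        ring
    _ ≤ 1 / r * ∫ θ in 0..π, (∑ i, directionalPart θ (w i)) ^ 2 +
          (∑ i, |directionalPart θ (w i)|) ^ 2 := by
        gcongr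
        exact le_integral_sq_sum_add_sq_sum_abs_directionalPart univ w
    _ ≤ ∫ θ in 0..π, ∑ i, ∑ j, (1 - G.adjMatrix ℝ i j) *
          (directionalPart θ (w i) * directionalPart θ (w j) +
            |directionalPart θ (w i)| * |directionalPart θ (w j)|) := by
        rw [← integral_const_mul]
        exact integral_mono_on pi_nonneg (Continuous.intervalIntegrable (by fun_prop) _ _)
          (Continuous.intervalIntegrable (by fun_prop) _ _)
          fun θ _ => sq_sum_add_sq_sum_abs_le hG fun i => directionalPart θ (w i)
    _ = ∑ i, ∑ j, (1 - G.adjMatrix ℝ i j) *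
          ∫ θ in 0..π, directionalPart θ (w i) * directionalPart θ (w j) +
            |directionalPart θ (w i)| * |directionalPart θ (w j)| := by
        rw [integral_finsetSum fun i _ => Continuous.intervalIntegrable (by fun_prop) _ _]
        refine sum_congr rfl fun i _ => ?_
        rw [integral_finsetSum fun j _ => Continuous.intervalIntegrable (by fun_prop) _ _]
        simp only [integral_const_mul]
    _ ≤ ∑ i, ∑ j, (1 - G.adjMatrix ℝ i j) * (π / 2 * (⟪w i, w j⟫_ℝ + ‖w i‖ * ‖w j‖)) := by
        gcongr
        · exact hnonneg _ _
        · exact integral_directionalPart_mul_add_abs_mul_abs_le _ _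
    _ = π / 2 * ∑ i, ∑ j, (1 - G.adjMatrix ℝ i j) * (⟪w i, w j⟫_ℝ + ‖w i‖ * ‖w j‖) := by
        simp only [mul_sum, mul_left_comm]

theorem inner_sq_add_norm_sq_mul_norm_sq (w z : ℂ) :
    ⟪w ^ 2, z ^ 2⟫_ℝ + ‖w ^ 2‖ * ‖z ^ 2‖ = 2 * ⟪w, z⟫_ℝ ^ 2 := by
  simp only [norm_pow, Complex.sq_norm, Complex.normSq_apply, Complex.inner]
  simp only [sq, Complex.mul_re, Complex.mul_im, Complex.conj_re, Complex.conj_im]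
  ring

theorem sum_sum_adjMatrix_mul_inner_sq_le (hG : G.CliqueFree (r + 1)) (z : V → ℂ) :
    ∑ i, ∑ j, G.adjMatrix ℝ i j * ⟪z i, z j⟫_ℝ ^ 2 ≤
      (1 - 8 / π ^ 2 / r) * ∑ i, ∑ j, ⟪z i, z j⟫_ℝ ^ 2 := by
  have h := sum_sum_inner_add_norm_mul_norm_le hG fun i => z i ^ 2
  simp only [inner_sq_add_norm_sq_mul_norm_sq, mul_left_comm _ (2 : ℝ), ← mul_sum, one_sub_mul,
    sum_sub_distrib] at h
  rw [one_sub_mul]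
  linarith

end MotzkinStraus

theorem le_eigenvalues_of_lt_finrank {𝕜 E : Type*} [RCLike 𝕜] [NormedAddCommGroup E]
    [InnerProductSpace 𝕜 E] [FiniteDimensional 𝕜 E] {T : E →ₗ[𝕜] E} (hT : T.IsSymmetric) {n : ℕ}
    (hn : Module.finrank 𝕜 E = n) {k : Fin n} {S : Submodule 𝕜 E}
    (hk : k < Module.finrank 𝕜 S) {c : ℝ}
    (hS : ∀ x ∈ S, c * ‖x‖ ^ 2 ≤ RCLike.re ⟪x, T x⟫_𝕜) : c ≤ hT.eigenvalues hn k := by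
  set b := hT.eigenvectorBasis hn
  obtain ⟨x, hxS, hx0, hxb⟩ : ∃ x ∈ S, x ≠ 0 ∧ ∀ j < k, ⟪b j, x⟫_𝕜 = 0 := by
    let f : S →ₗ[𝕜] Fin k → 𝕜 :=
      LinearMap.pi (fun j => innerₛₗ 𝕜 (b (j.castLE k.2.le))) ∘ₗ S.subtype
    have hf : LinearMap.ker f ≠ ⊥ := f.ker_ne_bot_of_finrank_lt (by simpa using hk)
    obtain ⟨x, hx, hx0⟩ := Submodule.exists_mem_ne_zero_of_ne_bot hf
    exact ⟨x, x.2, by simpa using hx0, fun j hj => congrFun hx ⟨j, hj⟩⟩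
  have hquad : RCLike.re ⟪x, T x⟫_𝕜 = ∑ j, hT.eigenvalues hn j * ‖⟪b j, x⟫_𝕜‖ ^ 2 := by
    rw [← b.sum_inner_mul_inner, map_sum]
    refine sum_congr rfl fun j _ => ?_
    rw [← hT, hT.apply_eigenvectorBasis, inner_smul_left, RCLike.conj_ofReal, mul_left_comm,
      RCLike.re_ofReal_mul, ← inner_conj_symm, RCLike.conj_mul, ← RCLike.ofReal_pow,
      RCLike.ofReal_re]
  refine le_of_mul_le_mul_right ?_ (pow_pos (norm_pos_iff.mpr hx0) 2)
  calc c * ‖x‖ ^ 2 ≤ RCLike.re ⟪x, T x⟫_𝕜 := hS x hxS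
    _ = ∑ j, hT.eigenvalues hn j * ‖⟪b j, x⟫_𝕜‖ ^ 2 := hquad
    _ ≤ ∑ j, hT.eigenvalues hn k * ‖⟪b j, x⟫_𝕜‖ ^ 2 := by
        refine sum_le_sum fun j _ => ?_
        rcases lt_or_ge j k with hj | hj
        · simp [hxb j hj]
        · gcongr
          exact hT.eigenvalues_antitone hn hj
    _ = hT.eigenvalues hn k * ‖x‖ ^ 2 := by rw [← mul_sum, b.sum_sq_norm_inner_right]

section AdjMatrix

variable {V : Type*} [Fintype V] (G : SimpleGraph V) [DecidableRel G.Adj]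

theorem sum_sum_adjMatrix_eq_two_mul_card_edgeFinset :
    ∑ i, ∑ j, G.adjMatrix ℝ i j = 2 * #G.edgeFinset := by
  have h := G.natCast_card_dart_eq_dotProduct (α := ℝ)
  rw [G.dart_card_eq_twice_card_edges, dotProduct_one, Nat.cast_mul, Nat.cast_ofNat] at h
  simpa only [Matrix.mulVec, dotProduct_one] using h.symm

theorem sq_sum_sum_adjMatrix_mul_le (M : V → V → ℝ) :
    (∑ i, ∑ j, G.adjMatrix ℝ i j * M i j) ^ 2 ≤
      2 * #G.edgeFinset * ∑ i, ∑ j, G.adjMatrix ℝ i j * M i j ^ 2 := by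
  have h := sum_sq_le_sum_mul_sum_of_sq_le_mul univ
    (r := fun p : V × V => G.adjMatrix ℝ p.1 p.2 * M p.1 p.2)
    (f := fun p => G.adjMatrix ℝ p.1 p.2) (g := fun p => G.adjMatrix ℝ p.1 p.2 * M p.1 p.2 ^ 2)
    (fun p _ => ?_) (fun p _ => ?_) fun p _ => ?_
  · simpa only [Fintype.sum_prod_type, sum_sum_adjMatrix_eq_two_mul_card_edgeFinset] using h
  all_goals
    rw [SimpleGraph.adjMatrix_apply]
    split_ifs <;> simp [sq_nonneg]

variable {G} in
theorem sq_sum_sum_adjMatrix_mul_inner_le {r : ℕ} (hG : G.CliqueFree (r + 1)) (z : V → ℂ) :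
    (∑ i, ∑ j, G.adjMatrix ℝ i j * ⟪z i, z j⟫_ℝ) ^ 2 ≤
      (1 - 8 / π ^ 2 / r) * (2 * #G.edgeFinset) * ∑ i, ∑ j, ⟪z i, z j⟫_ℝ ^ 2 :=
  calc (∑ i, ∑ j, G.adjMatrix ℝ i j * ⟪z i, z j⟫_ℝ) ^ 2
      ≤ 2 * #G.edgeFinset * ∑ i, ∑ j, G.adjMatrix ℝ i j * ⟪z i, z j⟫_ℝ ^ 2 :=
        sq_sum_sum_adjMatrix_mul_le G fun i j => ⟪z i, z j⟫_ℝ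
    _ ≤ 2 * #G.edgeFinset * ((1 - 8 / π ^ 2 / r) * ∑ i, ∑ j, ⟪z i, z j⟫_ℝ ^ 2) := by
        gcongr
        exact sum_sum_adjMatrix_mul_inner_sq_le hG z
    _ = _ := by ring

theorem inner_toEuclideanLin_adjMatrix [DecidableEq V] (x : EuclideanSpace ℝ V) :
    ⟪x, (G.adjMatrix ℝ).toEuclideanLin x⟫_ℝ = ∑ i, ∑ j, G.adjMatrix ℝ i j * (x i * x j) := by
  rw [EuclideanSpace.inner_eq_star_dotProduct, star_trivial, dotProduct_comm]
  simp only [Matrix.ofLp_toLpLin, Matrix.toLin'_apply, dotProduct, Matrix.mulVec, mul_sum,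
    mul_left_comm]

end AdjMatrix

theorem sum_sum_sq_mul_add_mul {ι : Type*} [Fintype ι] (x y : EuclideanSpace ℝ ι) (a b : ℝ) :
    ∑ i, ∑ j, (a * (x i * x j) + b * (y i * y j)) ^ 2 =
      a ^ 2 * ⟪x, x⟫_ℝ ^ 2 + 2 * (a * b) * ⟪x, y⟫_ℝ ^ 2 + b ^ 2 * ⟪y, y⟫_ℝ ^ 2 := by
  simp only [PiLp.inner_apply, sq, sum_mul_sum]
  simp only [mul_sum, ← sum_add_distrib, RCLike.inner_apply, conj_trivial]
  congr! 2
  ring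

theorem eight_div_pi_sq_div_natCast_le_one (r : ℕ) : 8 / π ^ 2 / r ≤ 1 := by
  have hpi : 8 / π ^ 2 ≤ 1 := by
    rw [div_le_one (by positivity)]
    nlinarith [pi_gt_three]
  rw [div_eq_mul_inv]
  exact mul_le_one₀ hpi (by positivity) (Nat.cast_inv_le_one r)

section Eigenvalues

variable {V : Type*} [Fintype V] [DecidableEq V] {G : SimpleGraph V} [DecidableRel G.Adj] {r : ℕ}

theorem adjEigenvalue_nonneg_of_isIndepSet {s : Finset V} (hs : G.IsIndepSet s)
    {k : ℕ} (hk : k < #s) : 0 ≤ G.adjEigenvalue k (hk.trans_le s.card_le_univ) := by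
  let f : (s → ℝ) →ₗ[ℝ] EuclideanSpace ℝ V :=
    (WithLp.linearEquiv 2 ℝ (V → ℝ)).symm.toLinearMap ∘ₗ
      Function.ExtendByZero.linearMap ℝ (Subtype.val : s → V)
  have hf : Function.Injective f := (WithLp.linearEquiv 2 ℝ (V → ℝ)).symm.injective.comp
    (Function.extend_injective Subtype.val_injective (0 : V → ℝ))
  have hS : k < Module.finrank ℝ (LinearMap.range f) := by
    simpa [LinearMap.finrank_range_of_inj hf] using hk
  refine le_eigenvalues_of_lt_finrank _ _ (k := ⟨k, _⟩) hS ?_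
  rintro _ ⟨x, rfl⟩
  have hzero (i : V) (hi : i ∉ s) : f x i = 0 :=
    Function.extend_apply' _ _ _ fun ⟨a, ha⟩ => hi (ha ▸ a.2)
  rw [zero_mul, inner_toEuclideanLin_adjMatrix]
  refine (sum_eq_zero fun i _ => sum_eq_zero fun j _ => ?_).ge
  by_cases hi : i ∈ s
  · by_cases hj : j ∈ s
    · have : ¬G.Adj i j := fun h => hs hi hj h.ne h
      simp [SimpleGraph.adjMatrix_apply, this]
    · simp [hzero j hj]
  · simp [hzero i hi]

theorem adjEigenvalue_one_nonneg (hG : G ≠ ⊤) :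
    0 ≤ G.adjEigenvalue 1 (SimpleGraph.one_lt_card_of_ne_top hG) := by
  obtain ⟨u, v, huv, hadj⟩ := SimpleGraph.ne_top_iff_exists_not_adj.mp hG
  refine adjEigenvalue_nonneg_of_isIndepSet (s := {u, v}) ?_ (card_pair huv).ge
  simpa [SimpleGraph.isIndepSet_iff, Set.pairwise_pair, G.adj_comm v u] using fun _ => hadj

theorem sq_add_sq_le_of_orthonormal_eigenvectors (hG : G.CliqueFree (r + 1))
    {x y : EuclideanSpace ℝ V} {l₁ l₂ : ℝ} (h₁ : 0 ≤ l₁) (h₂ : 0 ≤ l₂)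
    (hx : (G.adjMatrix ℝ).toEuclideanLin x = l₁ • x)
    (hy : (G.adjMatrix ℝ).toEuclideanLin y = l₂ • y)
    (hxx : ⟪x, x⟫_ℝ = 1) (hyy : ⟪y, y⟫_ℝ = 1) (hxy : ⟪x, y⟫_ℝ = 0) :
    l₁ ^ 2 + l₂ ^ 2 ≤ (1 - 8 / π ^ 2 / r) * (2 * #G.edgeFinset) := by
  let z (i : V) : ℂ := ⟨√l₁ * x i, √l₂ * y i⟩
  have hz (i j : V) : ⟪z i, z j⟫_ℝ = l₁ * (x i * x j) + l₂ * (y i * y j) := by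
    simp only [z, Complex.inner, Complex.mul_re, Complex.conj_re, Complex.conj_im]
    linear_combination (x i * x j) * mul_self_sqrt h₁ + (y i * y j) * mul_self_sqrt h₂
  have hadj : ∑ i, ∑ j, G.adjMatrix ℝ i j * ⟪z i, z j⟫_ℝ = l₁ ^ 2 + l₂ ^ 2 := by
    simp only [hz, mul_add, sum_add_distrib, mul_left_comm _ l₁, mul_left_comm _ l₂, ← mul_sum,
      ← inner_toEuclideanLin_adjMatrix, hx, hy, inner_smul_right, hxx, hyy]
    ring
  have hgram : ∑ i, ∑ j, ⟪z i, z j⟫_ℝ ^ 2 = l₁ ^ 2 + l₂ ^ 2 := by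
    simp only [hz, sum_sum_sq_mul_add_mul, hxx, hyy, hxy]
    ring
  have hcs := sq_sum_sum_adjMatrix_mul_inner_le hG z
  rw [hadj, hgram, sq] at hcs
  rcases (show 0 ≤ l₁ ^ 2 + l₂ ^ 2 by positivity).eq_or_lt with hzero | hpos
  · rw [← hzero]
    exact mul_nonneg (sub_nonneg.mpr (eight_div_pi_sq_div_natCast_le_one r)) (by positivity)
  · exact le_of_mul_le_mul_right hcs hpos

theorem adjEigenvalue_sq_add_adjEigenvalue_sq_le (hG : G.CliqueFree (r + 1)) {i j : ℕ}
    (hij : i ≠ j) {hi : i < Fintype.card V} {hj : j < Fintype.card V}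
    (hi₀ : 0 ≤ G.adjEigenvalue i hi) (hj₀ : 0 ≤ G.adjEigenvalue j hj) :
    G.adjEigenvalue i hi ^ 2 + G.adjEigenvalue j hj ^ 2 ≤
      (1 - 8 / π ^ 2 / r) * (2 * #G.edgeFinset) := by
  have hT := Matrix.isSymmetric_toEuclideanLin_iff.mpr G.isHermitian_adjMatrix_real
  let b := hT.eigenvectorBasis finrank_euclideanSpace
  exact sq_add_sq_le_of_orthonormal_eigenvectors hG hi₀ hj₀ (hT.apply_eigenvectorBasis _ ⟨i, hi⟩)
    (hT.apply_eigenvectorBasis _ ⟨j, hj⟩) (b.inner_eq_one _) (b.inner_eq_one _)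
    (b.inner_eq_zero (by simpa using hij))

end Eigenvalues

theorem cliqueFree_cliqueNum_add_one {V : Type*} [Finite V] {G : SimpleGraph V} :
    G.CliqueFree (G.cliqueNum + 1) := fun s hs => by
  have := hs.isClique.card_le_cliqueNum
  have := hs.card_eq
  lia

theorem pi_sq_div_eight_le : π ^ 2 / 8 ≤ 1 + (π ^ 2 - 4) / (π ^ 2 + 4) := by
  have hpi : π ^ 2 ≤ 12 := by nlinarith [pi_lt_d2, pi_pos]
  have h : 1 + (π ^ 2 - 4) / (π ^ 2 + 4) = 2 * π ^ 2 / (π ^ 2 + 4) := by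
    field_simp
    ring
  rw [h, div_le_div_iff₀ (by norm_num) (by positivity)]
  nlinarith [sq_nonneg π]

theorem theorem2_general {V : Type*} [Fintype V] [DecidableEq V] (G : SimpleGraph V)
    [DecidableRel G.Adj] (hG : G ≠ ⊤) (C : ℝ) (hC : π ^ 2 / 8 ≤ C) :
    G.adjEigenvalue 0 (zero_lt_one.trans (SimpleGraph.one_lt_card_of_ne_top hG)) ^ 2 +
        G.adjEigenvalue 1 (SimpleGraph.one_lt_card_of_ne_top hG) ^ 2 ≤
      (1 - 1 / (C * (G.cliqueNum : ℝ))) * (2 * (G.edgeFinset.card : ℝ)) := by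
  have h₂ := adjEigenvalue_one_nonneg hG
  have h₁ := h₂.trans <| G.isHermitian_adjMatrix_real.eigenvalues₀_antitone <|
    Fin.mk_le_mk (hx := zero_lt_one.trans (SimpleGraph.one_lt_card_of_ne_top hG)).mpr zero_le_one
  have hCinv : 1 / C ≤ 8 / π ^ 2 := by
    simpa using one_div_le_one_div_of_le (by positivity) hC
  refine (adjEigenvalue_sq_add_adjEigenvalue_sq_le cliqueFree_cliqueNum_add_one zero_ne_one
    h₁ h₂).trans ?_
  rw [← div_div]
  gcongr

theorem theorem2 {V : Type*} [Fintype V] [DecidableEq V] (G : SimpleGraph V)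
    [DecidableRel G.Adj] (hG : G ≠ ⊤) (C : ℝ)
    (hC : C = 1 + (Real.pi ^ 2 - 4) / (Real.pi ^ 2 + 4)) :
    G.adjEigenvalue 0 (zero_lt_one.trans (SimpleGraph.one_lt_card_of_ne_top hG)) ^ 2 +
        G.adjEigenvalue 1 (SimpleGraph.one_lt_card_of_ne_top hG) ^ 2 ≤
      (1 - 1 / (C * (G.cliqueNum : ℝ))) * (2 * (G.edgeFinset.card : ℝ)) :=
  theorem2_general G hG C (hC ▸ pi_sq_div_eight_le)
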